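/- Let $n\ge 0$ be an integer and write $[n]=\{1,\dots,n\}$. All expectations of functions on $\{0,1\}^n$ are with respect to the uniform measure. For a nonnegative $g:\{0,1\}^n\to\mathbb{R}$ let $$\mathrm{Ent}(g)=\mathbb{E}\,(g\log_2 g)-(\mathbb{E}\,g)\log_2(\mathbb{E}\,g)\qquad(0\log_2 0=0),$$ and for $A\subseteq[n]$ let $\mathrm{Ent}(g\,|\,A)=\mathrm{Ent}\big(\mathbb{E}(g\,|\,\{x_i\}_{i\in A})\big)$, where $\mathbb{E}(g\,|\,\{x_i\}_{i\in A})$ is the conditional expectation of $g$ given the coordinates in $A$. For $0\le\epsilon\le 1$ let $$(T_\epsilon g)(x)=\sum_{y\in\{0,1\}^n}\epsilon^{|y-x|}(1-\epsilon)^{n-|y-x|}g(y),$$ where $|y-x|$ is the Hamming distance. Mrs. Gerber's function is defined for $x\in[0,1]$ by $$\phi(x,\epsilon)=\mathrm{Ent}(T_\epsilon f_t),$$ where $f_t$ is the function on $\{0,1\}$ with $f_t(0)=t$ and $f_t(1)=2-t$, and $t\in[0,2]$ is chosen so that $\mathrm{Ent}(f_t)=x$ (such a $t$ exists, and the value does not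 depend on its choice). Theorem. Let $f:\{0,1\}^n\to\mathbb{R}$ be nonnegative with $\mathbb{E}f=1$, let $0<\epsilon<1$, and let $T$ be a random subset of $[n]$ that contains each element independently with probability $(1-2\epsilon)^2$. Then $$\mathrm{Ent}(T_\epsilon f)\;\le\;\mathbb{E}_T\Big(\mathrm{Ent}(f\,|\,T)-\sum_{i\in T}\mathrm{Ent}(f\,|\,\{i\})\Big)+\sum_{i=1}^n\phi\big(\mathrm{Ent}(f\,|\,\{i\}),\epsilon\big).$$ -/

import Mathlib

open Finset
open scoped BigOperators

namespace NoisyCube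

/-- The boolean cube of dimension `n` (`false` is `0`, `true` is `1`). -/
abbrev Cube (n : ℕ) : Type := Fin n → Bool

/-- The entropy functional `Ent f = 𝔼 (f log₂ f) - (𝔼 f) log₂ (𝔼 f)` with respect to the uniform
measure on the cube. Since `Real.logb 2 0 = 0`, the convention `0 log 0 = 0` holds. -/
noncomputable def ent {n : ℕ} (f : Cube n → ℝ) : ℝ :=
  (𝔼 x, f x * Real.logb 2 (f x)) - (𝔼 x, f x) * Real.logb 2 (𝔼 x, f x)

/-- The noise operator with parameter `ε`. -/
noncomputable def noise {n : ℕ} (ε : ℝ) (f : Cube n → ℝ) : Cube n → ℝ :=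
  fun x => ∑ y, ε ^ hammingDist y x * (1 - ε) ^ (n - hammingDist y x) * f y

/-- The conditional expectation of `f` given the coordinates in `A`, viewed as a function on the
whole cube: the value at `x` is the average of `f` over the points that agree with `x` on `A`. -/
noncomputable def condExpect {n : ℕ} (f : Cube n → ℝ) (A : Finset (Fin n)) : Cube n → ℝ :=
  fun x => 𝔼 y with ∀ i ∈ A, y i = x i, f y

/-- `Ent (f | A)`, the entropy of the conditional expectation of `f` given the coordinates
in `A`. -/
noncomputable def condEnt {n : ℕ} (f : Cube n → ℝ) (A : Finset (Fin n)) : ℝ :=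
  ent (condExpect f A)

/-- The expectation of `g T`, where `T` is a random subset of `Fin n` that contains each element
independently with probability `p`. -/
noncomputable def subsetExpect {n : ℕ} (p : ℝ) (g : Finset (Fin n) → ℝ) : ℝ :=
  ∑ T : Finset (Fin n), p ^ T.card * (1 - p) ^ (n - T.card) * g T

/-- The function on the two-point space (the cube of dimension one) with value `t` at zero and
`2 - t` at one. -/
def twoPoint (t : ℝ) : Cube 1 → ℝ :=
  fun x => if x 0 then 2 - t else t

open Classical in
/-- Mrs. Gerber's function: `φ(x, ε) = Ent (T_ε f_t)`, where `f_t` is the nonnegative two-point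
function above and `t` is chosen so that `Ent f_t = x`. For `0 ≤ x ≤ 1` such a `t` exists
(`exists_ent_twoPoint_eq`) and the value does not depend on it (`mrsGerber_ent_twoPoint`);
for all other `x` the value is irrelevant. -/
noncomputable def mrsGerber (x ε : ℝ) : ℝ :=
  if h : ∃ t ∈ Set.Icc (0 : ℝ) 2, ent (twoPoint t) = x then ent (noise ε (twoPoint h.choose)) else 0

theorem expect_cube_one (g : Cube 1 → ℝ) :
    (𝔼 x, g x) = (g (fun _ => false) + g (fun _ => true)) / 2 := by
  rw [Fintype.expect_eq_sum_div_card, ← (Equiv.funUnique (Fin 1) Bool).symm.sum_comp]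
  simp only [Fintype.sum_bool]
  have h : ∀ b, (Equiv.funUnique (Fin 1) Bool).symm b = fun _ => b := fun b => by ext; rfl
  simp [h, add_comm]

theorem ent_twoPoint (t : ℝ) :
    ent (twoPoint t) = 1 - Real.binEntropy (t / 2) / Real.log 2 := by
  have h2 : Real.log 2 ≠ 0 := (Real.log_pos one_lt_two).ne'
  have key : ∀ s : ℝ, s / 2 * Real.log (s / 2) = s / 2 * (Real.log s - Real.log 2) := by
    intro s
    rcases eq_or_ne s 0 with rfl | hs
    · simp
    · rw [Real.log_div hs two_ne_zero]
  have k1 := key t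
  have k2 := key (2 - t)
  have e : (2 - t) / 2 = 1 - t / 2 := by ring
  have e2 : (t + (2 - t)) / 2 = 1 := by ring
  rw [e] at k2
  simp only [ent, expect_cube_one, twoPoint, Real.binEntropy_eq_negMulLog_add_negMulLog_one_sub,
    Real.negMulLog, Real.logb]
  simp only [Bool.false_eq_true, if_false, if_true, e2, neg_mul, k1, k2, Real.log_one]
  field_simp
  ring

theorem noise_twoPoint (ε t : ℝ) :
    noise ε (twoPoint t) = twoPoint ((1 - ε) * t + ε * (2 - t)) := by
  have h : ∀ b, (Equiv.funUnique (Fin 1) Bool).symm b = fun _ => b := fun b => by ext; rfl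
  ext x
  obtain ⟨b, rfl⟩ : ∃ b, x = fun _ => b := ⟨x 0, by ext i; rw [Subsingleton.elim i 0]⟩
  simp only [noise]
  rw [← (Equiv.funUnique (Fin 1) Bool).symm.sum_comp]
  simp only [Fintype.sum_bool, h]
  cases b <;> simp [twoPoint, hammingDist] <;> ring

theorem exists_ent_twoPoint_eq {x : ℝ} (hx : x ∈ Set.Icc (0 : ℝ) 1) :
    ∃ t ∈ Set.Icc (0 : ℝ) 2, ent (twoPoint t) = x := by
  have hl : 0 < Real.log 2 := Real.log_pos one_lt_two
  have hc : ContinuousOn Real.binEntropy (Set.Icc 0 (2⁻¹)) :=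
    Real.binEntropy_continuous.continuousOn
  obtain ⟨p, hp, hpx⟩ : (1 - x) * Real.log 2 ∈ Real.binEntropy '' Set.Icc 0 (2⁻¹) := by
    refine intermediate_value_Icc (by norm_num) hc ?_
    rw [Real.binEntropy_zero, Real.binEntropy_two_inv]
    constructor <;> nlinarith [hx.1, hx.2]
  refine ⟨2 * p, ⟨by linarith [hp.1], by linarith [hp.2]⟩, ?_⟩
  rw [ent_twoPoint, mul_div_cancel_left₀ _ two_ne_zero, hpx]
  field_simp
  ring

theorem mrsGerber_ent_twoPoint {t : ℝ} (ht : t ∈ Set.Icc (0 : ℝ) 2) (ε : ℝ) :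
    mrsGerber (ent (twoPoint t)) ε = ent (noise ε (twoPoint t)) := by
  have hl : Real.log 2 ≠ 0 := (Real.log_pos one_lt_two).ne'
  have h : ∃ s ∈ Set.Icc (0 : ℝ) 2, ent (twoPoint s) = ent (twoPoint t) := ⟨t, ht, rfl⟩
  rw [mrsGerber, dif_pos h]
  obtain ⟨hs, he⟩ := h.choose_spec
  generalize h.choose = s at hs he
  have hb : Real.binEntropy (s / 2) = Real.binEntropy (t / 2) := by
    rw [ent_twoPoint, ent_twoPoint] at he
    field_simp at he
    linarith
  have inj := Real.binEntropy_strictMonoOn.injOn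
  have red : ∀ u ∈ Set.Icc (0 : ℝ) 2, ∃ v ∈ Set.Icc (0 : ℝ) 2⁻¹,
      Real.binEntropy v = Real.binEntropy (u / 2) ∧ (u = 2 * v ∨ u = 2 - 2 * v) := by
    intro u hu
    rcases le_total u 1 with h1 | h1
    · exact ⟨u / 2, ⟨by linarith [hu.1], by linarith⟩, rfl, Or.inl (by ring)⟩
    · exact ⟨1 - u / 2, ⟨by linarith [hu.2], by linarith⟩, Real.binEntropy_one_sub _,
        Or.inr (by ring)⟩
  obtain ⟨v, hv, hve, hv'⟩ := red s hs
  obtain ⟨w, hw, hwe, hw'⟩ := red t ht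
  have hvw : v = w := inj hv hw (by rw [hve, hwe, hb])
  subst hvw
  have sym : ∀ u, ent (noise ε (twoPoint (2 - 2 * u))) = ent (noise ε (twoPoint (2 * u))) := by
    intro u
    rw [noise_twoPoint, noise_twoPoint, ent_twoPoint, ent_twoPoint, ← Real.binEntropy_one_sub]
    congr 3
    ring
  rcases hv' with rfl | rfl <;> rcases hw' with rfl | rfl <;> simp [sym]

end NoisyCube

namespace NoisyCube

variable {n : ℕ}

/-! Let each coordinate carry its own correlation `r i`. Correlation `1 - 2 * ε` everywhere gives
`noise ε`, and the 0/1 indicator of `T` gives conditional expectation on `T`. So it suffices to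
compare correlation `ρ = 1 - 2 * ε` with correlations `1` and `0`, one coordinate at a time, with
weights `ρ ^ 2` and `1 - ρ ^ 2`; iterating produces the random set `T`.

For one coordinate, condition on the others: the bit is `0` with some probability `p` and passes
through a binary symmetric channel. With `H` the binary entropy, `H (channel s p) - s ^ 2 * H p` is
convex in `p` (`convexOn_binEntropy_channel`), so by Jensen its average is at least its value at the
mean of `p` (`ent_coordNoise_le`). That mean is the marginal of `f` at coordinate `i`, which noise
on the other coordinates does not change. Hence the error is `φ(Ent(f|{i}), ε) - ρ ^ 2 * Ent(f|{i})`
whatever the other correlations are, and the errors add up (`le_sum_powerset_of_coordinatewise`). -/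

/-- The sign `1` if two bits agree and `-1` otherwise. -/
def agreement (a b : Bool) : ℝ := if a = b then 1 else -1

/-- The product noise operator which acts on coordinate `i` with correlation `r i`. -/
noncomputable def productNoise (r : Fin n → ℝ) (f : Cube n → ℝ) : Cube n → ℝ :=
  fun x => 𝔼 y, (∏ i, (1 + r i * agreement (x i) (y i))) * f y

/-- The probability of `0` after a bit with probability `p` of `0` is sent through the binary
symmetric channel with correlation `s`. -/
noncomputable def channel (s p : ℝ) : ℝ := (1 + s) / 2 * p + (1 - s) / 2 * (1 - p)

/-- The noise operator with correlation `s` that acts on coordinate `i` only. -/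
noncomputable def coordNoise (i : Fin n) (s : ℝ) (g : Cube n → ℝ) : Cube n → ℝ :=
  fun x => (1 + s) / 2 * g x + (1 - s) / 2 * g (Function.update x i (!x i))

/-! ### Binary entropy along a binary symmetric channel -/

theorem channel_mem_Icc {s p : ℝ} (hs : s ∈ Set.Icc (-1 : ℝ) 1) (hp : p ∈ Set.Icc (0 : ℝ) 1) :
    channel s p ∈ Set.Icc (0 : ℝ) 1 := by
  obtain ⟨h1, h2⟩ := hs
  obtain ⟨h3, h4⟩ := hp
  unfold channel
  constructor <;> nlinarith

theorem hasDerivAt_channel (s p : ℝ) : HasDerivAt (channel s) s p := by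
  have h := ((hasDerivAt_id p).const_mul ((1 + s) / 2)).add
    (((hasDerivAt_id p).const_sub 1).const_mul ((1 - s) / 2))
  exact h.congr_deriv (by ring)

/-- With `q = channel s p`, the second derivative is `s ^ 2 * (1 / (p * (1 - p)) - 1 / (q * (1 -
q)))`, which is nonnegative because the channel moves `p` towards `1 / 2`. -/
theorem convexOn_binEntropy_channel {s : ℝ} (hs : s ∈ Set.Icc (-1 : ℝ) 1) :
    ConvexOn ℝ (Set.Icc 0 1)
      (fun p => Real.binEntropy (channel s p) - s ^ 2 * Real.binEntropy p) := by
  -- From `1 - 2 * channel s p = s * (1 - 2 * p)`, the two sides differ by `(1 - s ^ 2) * (1 - 2 *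
  -- p) ^ 2 / 4`.
  have hmem : ∀ p ∈ Set.Ioo (0 : ℝ) 1, p * (1 - p) ≤ channel s p * (1 - channel s p) := by
    intro p _
    have h2 : s ^ 2 ≤ 1 := by nlinarith [hs.1, hs.2]
    unfold channel
    nlinarith [mul_nonneg (sub_nonneg.2 h2) (sq_nonneg (1 - 2 * p))]
  have hpos : ∀ p ∈ Set.Ioo (0 : ℝ) 1, channel s p ∈ Set.Ioo (0 : ℝ) 1 := by
    intro p hp
    have h := channel_mem_Icc hs ⟨hp.1.le, hp.2.le⟩
    have h' := hmem p hp
    have h'' : 0 < p * (1 - p) := mul_pos hp.1 (sub_pos.2 hp.2)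
    constructor
    · refine h.1.lt_of_ne fun h0 => ?_
      rw [← h0] at h'
      linarith
    · refine h.2.lt_of_ne fun h0 => ?_
      rw [h0] at h'
      linarith
  have hc : Continuous (channel s) :=
    continuous_iff_continuousAt.2 fun p => (hasDerivAt_channel s p).continuousAt
  refine convexOn_of_hasDerivWithinAt2_nonneg (convex_Icc 0 1)
    (f' := fun p => (Real.log (1 - channel s p) - Real.log (channel s p)) * s
      - s ^ 2 * (Real.log (1 - p) - Real.log p))
    (f'' := fun p => (-s / (1 - channel s p) - s / channel s p) * s
      - s ^ 2 * (-1 / (1 - p) - 1 / p)) ?_ ?_ ?_ ?_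
  · exact ((Real.binEntropy_continuous.comp hc).sub
      (continuous_const.mul Real.binEntropy_continuous)).continuousOn
  · intro p hp
    rw [interior_Icc] at hp ⊢
    have hq := hpos p hp
    exact (((Real.hasDerivAt_binEntropy hq.1.ne' hq.2.ne).comp p (hasDerivAt_channel s p)).sub
      ((Real.hasDerivAt_binEntropy hp.1.ne' hp.2.ne).const_mul _)).hasDerivWithinAt
  · intro p hp
    rw [interior_Icc] at hp ⊢
    have hq := hpos p hp
    have d := hasDerivAt_channel s p
    exact ((((d.const_sub 1).log (sub_pos.2 hq.2).ne').sub (d.log hq.1.ne')).mul_const s |>.sub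
      (((((hasDerivAt_id p).const_sub 1).log (sub_pos.2 hp.2).ne').sub
        ((hasDerivAt_id p).log hp.1.ne')).const_mul (s ^ 2))).hasDerivWithinAt
  · intro p hp
    rw [interior_Icc] at hp
    have hq := hpos p hp
    have h1 := sub_pos.2 hq.2
    have h2 := sub_pos.2 hp.2
    have e : (-s / (1 - channel s p) - s / channel s p) * s - s ^ 2 * (-1 / (1 - p) - 1 / p)
        = s ^ 2 * (1 / (p * (1 - p)) - 1 / (channel s p * (1 - channel s p))) := by
      have := hq.1.ne'
      have := hp.1.ne'
      have := h1.ne'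
      have := h2.ne'
      field_simp
      ring
    rw [e]
    exact mul_nonneg (sq_nonneg s) (sub_nonneg.2
      (one_div_le_one_div_of_le (mul_pos hp.1 h2) (hmem p hp)))

/-- The chain rule for the entropy of a pair of masses that is sent through a channel. -/
theorem mul_log_add_mul_log_channel {a b : ℝ} (ha : 0 ≤ a) (hb : 0 ≤ b) (s : ℝ) :
    (((1 + s) / 2 * a + (1 - s) / 2 * b) * Real.log ((1 + s) / 2 * a + (1 - s) / 2 * b)
      + ((1 + s) / 2 * b + (1 - s) / 2 * a) * Real.log ((1 + s) / 2 * b + (1 - s) / 2 * a)) / 2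
    = (a + b) / 2 * Real.log ((a + b) / 2) + (a + b) / 2 * Real.log 2
      - (a + b) / 2 * Real.binEntropy (channel s (a / (a + b))) := by
  rcases (add_nonneg ha hb).eq_or_lt with h | h
  · obtain rfl : a = 0 := by linarith
    obtain rfl : b = 0 := by linarith
    simp
  have hne := h.ne'
  have h1 : (1 + s) / 2 * a + (1 - s) / 2 * b = (a + b) * channel s (a / (a + b)) := by
    unfold channel
    field_simp
    ring
  have h2 : (1 + s) / 2 * b + (1 - s) / 2 * a = (a + b) * (1 - channel s (a / (a + b))) := by
    unfold channel
    field_simp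
    ring
  have k1 := Real.negMulLog_mul (a + b) (channel s (a / (a + b)))
  have k2 := Real.negMulLog_mul (a + b) (1 - channel s (a / (a + b)))
  rw [h1, h2, Real.binEntropy_eq_negMulLog_add_negMulLog_one_sub,
    Real.log_div hne two_ne_zero]
  simp only [Real.negMulLog] at k1 k2 ⊢
  linear_combination (-1 / 2) * k1 - 1 / 2 * k2

/-! ### Noise on one coordinate of the cube -/

theorem involutive_flip (i : Fin n) :
    Function.Involutive fun x : Cube n => Function.update x i (!x i) := by
  intro x
  simp

theorem expect_eq_expect_update (i : Fin n) (F : Cube n → ℝ) :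
    (𝔼 x, F x) = 𝔼 x, (F (Function.update x i false) + F (Function.update x i true)) / 2 := by
  have h : (𝔼 x, F (Function.update x i (!x i))) = 𝔼 x, F x :=
    Fintype.expect_equiv (involutive_flip i).toPerm _ _ fun _ => rfl
  have h2 : (𝔼 x, F x) = 𝔼 x, (F x + F (Function.update x i (!x i))) / 2 := by
    rw [← Finset.expect_div, Finset.expect_add_distrib, h]
    ring
  rw [h2]
  refine Finset.expect_congr rfl fun x _ => ?_
  have hx : F x = F (Function.update x i (x i)) := by simp
  rw [hx]
  cases x i <;> simp [add_comm]

theorem expect_eval (i : Fin n) (u : Bool → ℝ) :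
    (𝔼 x : Cube n, u (x i)) = (u false + u true) / 2 := by
  rw [expect_eq_expect_update i]
  simp

theorem ent_of_expect_eq_one {g : Cube n → ℝ} (hg : (𝔼 x, g x) = 1) :
    ent g = (𝔼 x, g x * Real.log (g x)) / Real.log 2 := by
  rw [ent, hg, Real.logb_one, mul_zero, sub_zero, Finset.expect_div]
  simp only [Real.logb, mul_div_assoc]

theorem expect_coordNoise (i : Fin n) (s : ℝ) (g : Cube n → ℝ) :
    (𝔼 x, coordNoise i s g x) = 𝔼 x, g x := by
  rw [expect_eq_expect_update i, expect_eq_expect_update i g]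
  refine Finset.expect_congr rfl fun x _ => ?_
  simp only [coordNoise, Function.update_self, Function.update_idem, Bool.not_false,
    Bool.not_true]
  ring

theorem ent_coordNoise {g : Cube n → ℝ} (hg : ∀ x, 0 ≤ g x) (hmean : (𝔼 x, g x) = 1)
    (i : Fin n) (s : ℝ) :
    ent (coordNoise i s g) =
      ((𝔼 x, (g (Function.update x i false) + g (Function.update x i true)) / 2
          * Real.log ((g (Function.update x i false) + g (Function.update x i true)) / 2))
        + Real.log 2
        - 𝔼 x, (g (Function.update x i false) + g (Function.update x i true)) / 2
          * Real.binEntropy (channel s (g (Function.update x i false)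
            / (g (Function.update x i false) + g (Function.update x i true))))) / Real.log 2 := by
  rw [ent_of_expect_eq_one (by rw [expect_coordNoise, hmean]), expect_eq_expect_update i]
  congr 1
  have hm : (𝔼 x, (g (Function.update x i false) + g (Function.update x i true)) / 2
      * Real.log 2) = Real.log 2 := by
    rw [← Finset.expect_mul, ← expect_eq_expect_update, hmean, one_mul]
  conv_rhs => rw [← hm, ← Finset.expect_add_distrib, ← Finset.expect_sub_distrib]
  refine Finset.expect_congr rfl fun x _ => ?_
  rw [← mul_log_add_mul_log_channel (hg _) (hg _)]
  simp only [coordNoise, Function.update_self, Function.update_idem, Bool.not_false,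
    Bool.not_true]

/-- The strong data processing inequality for the binary symmetric channel: `p` is the mean of
the conditional probabilities that coordinate `i` is `0`. -/
theorem ent_coordNoise_le {g : Cube n → ℝ} (hg : ∀ x, 0 ≤ g x) (hmean : (𝔼 x, g x) = 1)
    (i : Fin n) {s : ℝ} (hs : s ∈ Set.Icc (-1 : ℝ) 1) {p : ℝ}
    (hp : (𝔼 x, g (Function.update x i false)) / 2 = p) :
    ent (coordNoise i s g) ≤ s ^ 2 * ent (coordNoise i 1 g) + (1 - s ^ 2) * ent (coordNoise i 0 g)
      + ((1 - Real.binEntropy (channel s p) / Real.log 2)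
        - s ^ 2 * (1 - Real.binEntropy p / Real.log 2)) := by
  have hl : 0 < Real.log 2 := Real.log_pos one_lt_two
  set a : Cube n → ℝ := fun x => g (Function.update x i false) with ha
  set b : Cube n → ℝ := fun x => g (Function.update x i true) with hb
  have ha0 : ∀ x, 0 ≤ a x := fun x => hg _
  have hb0 : ∀ x, 0 ≤ b x := fun x => hg _
  have hab : (𝔼 x, (a x + b x) / 2) = 1 := by rw [← hmean, expect_eq_expect_update i g]
  have ent_eq : ∀ s, ent (coordNoise i s g) = ((𝔼 x, (a x + b x) / 2 * Real.log ((a x + b x) / 2))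
      + Real.log 2 - 𝔼 x, (a x + b x) / 2
        * Real.binEntropy (channel s (a x / (a x + b x)))) / Real.log 2 :=
    ent_coordNoise hg hmean i
  have h0 : (𝔼 x, (a x + b x) / 2 * Real.binEntropy (channel 0 (a x / (a x + b x))))
      = Real.log 2 := by
    have : ∀ q, channel 0 q = 2⁻¹ := fun q => by unfold channel; ring
    simp only [this, Real.binEntropy_two_inv]
    rw [← Finset.expect_mul, hab, one_mul]
  have h1 : ∀ q, channel 1 q = q := fun q => by unfold channel; ring
  -- Jensen over the other coordinates: `(a x + b x) / 2` is their density and `a x / (a x + b x)`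
  -- the conditional probability that bit `i` is `0`.
  have jensen : Real.binEntropy (channel s p) - s ^ 2 * Real.binEntropy p ≤
      (𝔼 x, (a x + b x) / 2 * Real.binEntropy (channel s (a x / (a x + b x))))
        - s ^ 2 * 𝔼 x, (a x + b x) / 2 * Real.binEntropy (a x / (a x + b x)) := by
    have hN : (0 : ℝ) < Fintype.card (Cube n) := by
      exact_mod_cast Fintype.card_pos
    have h := (convexOn_binEntropy_channel hs).map_sum_le (t := Finset.univ)
      (w := fun x => (a x + b x) / 2 / Fintype.card (Cube n)) (p := fun x => a x / (a x + b x))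
      (fun x _ => div_nonneg (div_nonneg (add_nonneg (ha0 x) (hb0 x)) zero_le_two) hN.le)
      (by rw [← Finset.sum_div, ← Fintype.expect_eq_sum_div_card, hab])
      (fun x _ => ⟨div_nonneg (ha0 x) (add_nonneg (ha0 x) (hb0 x)),
        div_le_one_of_le₀ (by linarith [hb0 x]) (add_nonneg (ha0 x) (hb0 x))⟩)
    simp only [smul_eq_mul] at h
    have e : ∑ x, (a x + b x) / 2 / Fintype.card (Cube n) * (a x / (a x + b x)) = p := by
      rw [← hp, Fintype.expect_eq_sum_div_card, Finset.sum_div, Finset.sum_div]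
      refine Finset.sum_congr rfl fun x _ => ?_
      -- On a fibre of mass zero the ratio is `0 / 0 = 0`, harmless because its weight vanishes.
      rcases (add_nonneg (ha0 x) (hb0 x)).eq_or_lt with hx | hx
      · have : a x = 0 := by linarith [ha0 x, hb0 x]
        change _ = a x / _ / _
        simp [this]
      · change _ = a x / _ / _
        field_simp
    rw [e] at h
    refine h.trans_eq ?_
    rw [Finset.mul_expect, ← Finset.expect_sub_distrib, Fintype.expect_eq_sum_div_card,
      Finset.sum_div]
    refine Finset.sum_congr rfl fun x _ => ?_
    ring
  rw [ent_eq s, ent_eq 1, ent_eq 0, h0]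
  simp only [h1]
  rw [← sub_nonneg] at jensen ⊢
  refine (div_nonneg jensen hl.le).trans_eq ?_
  field_simp
  ring

/-! ### Product noise, with `noise` and `condExpect` as special cases -/

theorem agreement_self (a : Bool) : agreement a a = 1 := if_pos rfl

theorem agreement_of_ne {a b : Bool} (h : a ≠ b) : agreement a b = -1 := if_neg h

theorem agreement_not_left (a b : Bool) : agreement (!a) b = -agreement a b := by
  cases a <;> cases b <;> simp [agreement]

theorem agreement_eq_or (a b : Bool) : agreement a b = 1 ∨ agreement a b = -1 := by
  unfold agreement
  split_ifs <;> simp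

theorem one_add_mul_agreement_nonneg {s : ℝ} (hs : s ∈ Set.Icc (-1 : ℝ) 1) (a b : Bool) :
    0 ≤ 1 + s * agreement a b := by
  rcases agreement_eq_or a b with h | h <;> rw [h] <;> linarith [hs.1, hs.2]

theorem productNoise_nonneg {r : Fin n → ℝ} (hr : ∀ i, r i ∈ Set.Icc (-1 : ℝ) 1)
    {f : Cube n → ℝ} (hf : ∀ x, 0 ≤ f x) (x : Cube n) : 0 ≤ productNoise r f x :=
  Finset.expect_nonneg fun y _ => mul_nonneg
    (Finset.prod_nonneg fun i _ => one_add_mul_agreement_nonneg (hr i) _ _) (hf y)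

theorem card_cube : Fintype.card (Cube n) = 2 ^ n := by simp

theorem expect_prod_agreement (r : Fin n → ℝ) (y : Cube n) :
    (𝔼 x : Cube n, ∏ i, (1 + r i * agreement (x i) (y i))) = 1 := by
  have h : ∑ x : Cube n, ∏ i, (1 + r i * agreement (x i) (y i)) = 2 ^ n := by
    rw [← Fintype.prod_sum (fun i b => 1 + r i * agreement b (y i))]
    have : ∀ i, ∑ b, (1 + r i * agreement b (y i)) = 2 := by
      intro i
      cases y i <;> simp [agreement] <;> ring
    rw [Finset.prod_congr rfl fun i _ => this i]
    simp
  rw [Fintype.expect_eq_sum_div_card, h, card_cube]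
  simp

/-- With correlation `1` at `i`, the kernel vanishes unless `x i = y i`, and it averages to `1` over
`x`. This is why the marginal at `i` ignores the noise elsewhere. -/
theorem expect_eval_mul_productNoise {r : Fin n → ℝ} {i : Fin n} (hr : r i = 1) (u : Bool → ℝ)
    (f : Cube n → ℝ) :
    (𝔼 x, u (x i) * productNoise r f x) = 𝔼 y, u (y i) * f y := by
  simp only [productNoise, Finset.mul_expect]
  rw [Finset.expect_comm]
  refine Finset.expect_congr rfl fun y _ => ?_
  have h : ∀ x : Cube n, u (x i) * ((∏ j, (1 + r j * agreement (x j) (y j))) * f y)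
      = (∏ j, (1 + r j * agreement (x j) (y j))) * (u (y i) * f y) := by
    intro x
    by_cases hx : x i = y i
    · rw [hx]
      ring
    · rw [Finset.prod_eq_zero (Finset.mem_univ i)]
      · simp
      · rw [hr, agreement_of_ne hx]
        norm_num
  simp only [h]
  rw [← Finset.expect_mul, expect_prod_agreement, one_mul]

/-- The kernel factor splits as `1 + s * a = (1 + s) / 2 * (1 + a) + (1 - s) / 2 * (1 - a)`, and
flipping bit `i` changes the sign of `a`. -/
theorem productNoise_update (r : Fin n → ℝ) (i : Fin n) (s : ℝ) (f : Cube n → ℝ) :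
    productNoise (Function.update r i s) f
      = coordNoise i s (productNoise (Function.update r i 1) f) := by
  ext x
  simp only [productNoise, coordNoise, Finset.mul_expect]
  rw [← Finset.expect_add_distrib]
  refine Finset.expect_congr rfl fun y _ => ?_
  have split : ∀ (t : ℝ) (z : Cube n), (∀ j, j ≠ i → z j = x j) →
      ∏ j, (1 + Function.update r i t j * agreement (z j) (y j))
        = (1 + t * agreement (z i) (y i))
          * ∏ j ∈ Finset.univ.erase i, (1 + r j * agreement (x j) (y j)) := by
    intro t z hz
    rw [← Finset.mul_prod_erase _ _ (Finset.mem_univ i), Function.update_self]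
    congr 1
    refine Finset.prod_congr rfl fun j hj => ?_
    have := Finset.ne_of_mem_erase hj
    rw [Function.update_of_ne this, hz j this]
  rw [split s x fun _ _ => rfl, split 1 x fun _ _ => rfl,
    split 1 _ fun j hj => Function.update_of_ne hj _ _, Function.update_self, agreement_not_left]
  ring

theorem noise_eq_productNoise (ε : ℝ) (f : Cube n → ℝ) :
    noise ε f = productNoise (fun _ => 1 - 2 * ε) f := by
  ext x
  rw [productNoise, Fintype.expect_eq_sum_div_card, card_cube, Finset.sum_div]
  refine Finset.sum_congr rfl fun y _ => ?_
  have h : ∀ i, 1 + (1 - 2 * ε) * agreement (x i) (y i)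
      = 2 * if y i ≠ x i then ε else 1 - ε := by
    intro i
    by_cases hi : y i = x i
    · rw [hi, agreement_self, if_neg (by simp)]
      ring
    · rw [agreement_of_ne (Ne.symm hi), if_pos hi]
      ring
  have hc : (Finset.univ.filter fun i => ¬ y i ≠ x i).card = n - hammingDist y x := by
    have := Finset.card_filter_add_card_filter_not (s := Finset.univ) (fun i => y i ≠ x i)
    rw [Finset.card_univ, Fintype.card_fin] at this
    exact Nat.eq_sub_of_add_eq' this
  simp only [h]
  rw [Finset.prod_mul_distrib, Finset.prod_ite, Finset.prod_const, Finset.prod_const,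
    Finset.prod_const, hc, Finset.card_univ, Fintype.card_fin, ← hammingDist]
  push_cast
  field_simp

theorem condExpect_eq_productNoise (f : Cube n → ℝ) (A : Finset (Fin n)) :
    condExpect f A = productNoise (fun i => if i ∈ A then 1 else 0) f := by
  ext x
  have h : ∀ y : Cube n, ∏ i, (1 + (if i ∈ A then 1 else 0) * agreement (x i) (y i))
      = if ∀ i ∈ A, y i = x i then (2 : ℝ) ^ A.card else 0 := by
    intro y
    split_ifs with hy
    · rw [← Finset.prod_const, ← Finset.prod_subset (Finset.subset_univ A)]
      · refine Finset.prod_congr rfl fun i hi => ?_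
        rw [if_pos hi, hy i hi, agreement_self]
        norm_num
      · intro i _ hi
        simp [hi]
    · push Not at hy
      obtain ⟨i, hi, hne⟩ := hy
      refine Finset.prod_eq_zero (Finset.mem_univ i) ?_
      rw [if_pos hi, agreement_of_ne (Ne.symm hne)]
      norm_num
  have e : ∀ F : Cube n → ℝ, productNoise (fun i => if i ∈ A then 1 else 0) F x
      = 2 ^ A.card * (∑ y with ∀ i ∈ A, y i = x i, F y) / 2 ^ n := by
    intro F
    rw [productNoise, Fintype.expect_eq_sum_div_card, card_cube, Finset.sum_filter,
      Finset.mul_sum]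
    push_cast
    congr 1
    refine Finset.sum_congr rfl fun y _ => ?_
    rw [h]
    split_ifs <;> simp
  -- Applying `e` to the constant `1` gives the size of the fibre without counting it.
  have hone : productNoise (fun i => if i ∈ A then 1 else 0) (fun _ => 1) x = 1 := by
    have hcomm : ∀ a b, agreement a b = agreement b a := fun a b => by
      simp only [agreement, eq_comm]
    have := expect_prod_agreement (fun i => if i ∈ A then 1 else 0) x
    simpa only [productNoise, mul_one, hcomm] using this
  rw [e, Finset.sum_const, nsmul_eq_mul, mul_one] at hone
  have hcard : ((Finset.univ.filter fun y : Cube n => ∀ i ∈ A, y i = x i).card : ℝ) ≠ 0 := by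
    intro h0
    rw [h0] at hone
    simp at hone
  rw [e, condExpect, Finset.expect_eq_sum_div_card, div_eq_iff hcard]
  linear_combination (-∑ y with ∀ i ∈ A, y i = x i, f y) * hone

theorem condEnt_singleton {f : Cube n → ℝ} (hmean : (𝔼 x, f x) = 1) (i : Fin n) :
    condEnt f {i} = ent (twoPoint (2 * 𝔼 x, (if x i then 0 else 1) * f x)) := by
  have h : condExpect f {i}
      = fun x => twoPoint (2 * 𝔼 x, (if x i then 0 else 1) * f x) fun _ => x i := by
    rw [condExpect_eq_productNoise]
    ext x
    have hprod : ∀ y : Cube n, ∏ j, (1 + (if j ∈ ({i} : Finset (Fin n)) then 1 else 0)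
        * agreement (x j) (y j)) = 1 + agreement (x i) (y i) := by
      intro y
      rw [Finset.prod_eq_single i]
      · simp
      · intro j _ hj
        simp [hj]
      · simp
    simp only [productNoise, hprod, twoPoint]
    split_ifs with hx
    · have h2 : (2 : ℝ) = 𝔼 x, 2 * f x := by rw [← Finset.mul_expect, hmean, mul_one]
      conv_rhs => rw [Finset.mul_expect]; lhs; rw [h2]
      rw [← Finset.expect_sub_distrib]
      refine Finset.expect_congr rfl fun y _ => ?_
      rw [hx, agreement]
      cases y i
      · simp
      · simp only [if_true]
        ring
    · rw [Finset.mul_expect]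
      refine Finset.expect_congr rfl fun y _ => ?_
      rw [Bool.eq_false_iff.2 hx, agreement]
      cases y i
      · simp only [if_true, Bool.false_eq_true, if_false]
        ring
      · simp
  rw [condEnt, h, ent, ent, expect_cube_one, expect_cube_one,
    expect_eval i fun b => twoPoint _ fun _ => b,
    expect_eval i fun b => twoPoint _ (fun _ => b) * Real.logb 2 (twoPoint _ fun _ => b)]

/-! ### Interpolation over random subsets -/

/-- A functional that lies below its chord from `0` to `1` in each coordinate, up to an additive
error, lies below its multilinear interpolation, up to the sum of the errors. -/
theorem le_sum_powerset_of_coordinatewise {ι : Type*} [DecidableEq ι] {I : Set ℝ}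
    (h0 : (0 : ℝ) ∈ I) (h1 : (1 : ℝ) ∈ I) {ρ q : ℝ} (hρ : ρ ∈ I) (hq0 : 0 ≤ q) (hq1 : q ≤ 1)
    (Ψ : (ι → ℝ) → ℝ) (c : ι → ℝ)
    (step : ∀ r : ι → ℝ, (∀ i, r i ∈ I) → ∀ i, Ψ (Function.update r i ρ)
      ≤ q * Ψ (Function.update r i 1) + (1 - q) * Ψ (Function.update r i 0) + c i)
    (S : Finset ι) (r : ι → ℝ) (hr : ∀ i, r i ∈ I) :
    Ψ (S.piecewise (fun _ => ρ) r) ≤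
      ∑ T ∈ S.powerset, q ^ T.card * (1 - q) ^ (S.card - T.card)
        * Ψ (S.piecewise (fun i => if i ∈ T then 1 else 0) r) + ∑ i ∈ S, c i := by
  induction S using Finset.induction_on generalizing r with
  | empty => simp
  | insert i S hi ih =>
    have hup : ∀ t ∈ I, ∀ j, Function.update r i t j ∈ I := by
      intro t ht j
      rcases eq_or_ne j i with rfl | hj
      · simpa using ht
      · simpa [hj] using hr j
    have comm : ∀ (t : ℝ) (g : ι → ℝ), g i = t → (insert i S).piecewise g r
        = Function.update (S.piecewise g r) i t := by
      intro t g hg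
      rw [Finset.piecewise_insert, hg]
    have comm' : ∀ (t : ℝ) (g : ι → ℝ), Function.update (S.piecewise g r) i t
        = S.piecewise g (Function.update r i t) := by
      intro t g
      rw [Finset.update_piecewise_of_notMem _ _ _ hi]
    have hmem : ∀ j, S.piecewise (fun _ => ρ) r j ∈ I := by
      intro j
      by_cases hj : j ∈ S
      · simpa [hj] using hρ
      · simpa [hj] using hr j
    have hs := step _ hmem i
    rw [comm ρ _ rfl]
    refine hs.trans ?_
    -- The value `1` or `0` at `i` is absorbed into `r`, so the induction hypothesis applies to the
    -- modified vector; the two cases are the subsets with and without `i`.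
    rw [comm', comm', Finset.sum_powerset_insert hi, Finset.sum_insert hi]
    have i1 := mul_le_mul_of_nonneg_left (ih _ (hup 1 h1)) hq0
    have i0 := mul_le_mul_of_nonneg_left (ih _ (hup 0 h0)) (sub_nonneg.2 hq1)
    have e1 : q * ∑ T ∈ S.powerset, q ^ T.card * (1 - q) ^ (S.card - T.card)
        * Ψ (S.piecewise (fun j => if j ∈ T then 1 else 0) (Function.update r i 1))
        = ∑ T ∈ S.powerset, q ^ (insert i T).card
          * (1 - q) ^ ((insert i S).card - (insert i T).card)
          * Ψ ((insert i S).piecewise (fun j => if j ∈ insert i T then 1 else 0) r) := by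
      rw [Finset.mul_sum]
      refine Finset.sum_congr rfl fun T hT => ?_
      have hiT : i ∉ T := fun h => hi (Finset.mem_powerset.1 hT h)
      have hpw : S.piecewise (fun j => if j ∈ insert i T then (1 : ℝ) else 0)
          (Function.update r i 1)
          = S.piecewise (fun j => if j ∈ T then 1 else 0) (Function.update r i 1) := by
        refine Finset.piecewise_congr _ (fun j hj => ?_) fun _ _ => rfl
        have hji : j ≠ i := fun h => hi (h ▸ hj)
        simp [hji]
      rw [comm 1 _ (by simp), comm', hpw, Finset.card_insert_of_notMem hi,
        Finset.card_insert_of_notMem hiT, Nat.add_sub_add_right]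
      ring
    have e0 : (1 - q) * ∑ T ∈ S.powerset, q ^ T.card * (1 - q) ^ (S.card - T.card)
        * Ψ (S.piecewise (fun j => if j ∈ T then 1 else 0) (Function.update r i 0))
        = ∑ T ∈ S.powerset, q ^ T.card * (1 - q) ^ ((insert i S).card - T.card)
          * Ψ ((insert i S).piecewise (fun j => if j ∈ T then 1 else 0) r) := by
      rw [Finset.mul_sum]
      refine Finset.sum_congr rfl fun T hT => ?_
      have hTS := Finset.mem_powerset.1 hT
      have hiT : i ∉ T := fun h => hi (hTS h)
      rw [comm 0 _ (by simp [hiT]), comm', Finset.card_insert_of_notMem hi,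
        Nat.sub_add_comm (Finset.card_le_card hTS)]
      ring
    rw [mul_add] at i1 i0
    rw [e1] at i1
    rw [e0] at i0
    linarith

/-! ### The one-coordinate inequality in terms of `f`, and the conclusion -/

theorem expect_productNoise_update_one (r : Fin n → ℝ) (i : Fin n) (f : Cube n → ℝ) :
    (𝔼 x, productNoise (Function.update r i 1) f x) = 𝔼 x, f x := by
  simpa using expect_eval_mul_productNoise (Function.update_self i 1 r) (fun _ => 1) f

theorem expect_update_false (i : Fin n) (g : Cube n → ℝ) :
    (𝔼 x, g (Function.update x i false)) / 2 = 𝔼 x, (if x i then 0 else 1) * g x := by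
  rw [expect_eq_expect_update i fun x => (if x i then 0 else 1) * g x, Finset.expect_div]
  simp

theorem ent_productNoise_update_le {f : Cube n → ℝ} (hf : ∀ x, 0 ≤ f x)
    (hmean : (𝔼 x, f x) = 1) {ε : ℝ} (hε0 : 0 ≤ ε) (hε1 : ε ≤ 1) {r : Fin n → ℝ}
    (hr : ∀ i, r i ∈ Set.Icc (-1 : ℝ) 1) (i : Fin n) :
    ent (productNoise (Function.update r i (1 - 2 * ε)) f)
      ≤ (1 - 2 * ε) ^ 2 * ent (productNoise (Function.update r i 1) f)
        + (1 - (1 - 2 * ε) ^ 2) * ent (productNoise (Function.update r i 0) f)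
        + (mrsGerber (condEnt f {i}) ε - (1 - 2 * ε) ^ 2 * condEnt f {i}) := by
  have hr1 : ∀ j, Function.update r i 1 j ∈ Set.Icc (-1 : ℝ) 1 := by
    intro j
    rcases eq_or_ne j i with rfl | hj
    · simp
    · simpa [hj] using hr j
  have hg := productNoise_nonneg hr1 hf
  have hgm : (𝔼 x, productNoise (Function.update r i 1) f x) = 1 := by
    rw [expect_productNoise_update_one, hmean]
  set p := 𝔼 x, (if x i then 0 else 1) * f x with hp
  have hpg : (𝔼 x, productNoise (Function.update r i 1) f (Function.update x i false)) / 2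
      = p := by
    rw [expect_update_false]
    exact expect_eval_mul_productNoise (Function.update_self i 1 r) (fun b => if b then 0 else 1) f
  have hp0 : 0 ≤ p := Finset.expect_nonneg fun x _ => by
    have := hf x
    split_ifs <;> simp [this]
  have hp1 : p ≤ 1 := by
    rw [← hmean]
    refine Finset.expect_le_expect fun x _ => ?_
    have := hf x
    split_ifs <;> simp [this]
  have h := ent_coordNoise_le hg hgm i (s := 1 - 2 * ε) ⟨by linarith, by linarith⟩ hpg
  rw [← productNoise_update, ← productNoise_update, ← productNoise_update] at h
  have hφ : mrsGerber (condEnt f {i}) ε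
      = 1 - Real.binEntropy (channel (1 - 2 * ε) p) / Real.log 2 := by
    rw [condEnt_singleton hmean, ← hp, mrsGerber_ent_twoPoint ⟨by linarith, by linarith⟩,
      noise_twoPoint, ent_twoPoint]
    congr 3
    unfold channel
    ring
  have he : condEnt f {i} = 1 - Real.binEntropy p / Real.log 2 := by
    rw [condEnt_singleton hmean, ← hp, ent_twoPoint, mul_div_cancel_left₀ _ two_ne_zero]
  rw [hφ, he]
  exact h

end NoisyCube

theorem theorem1p7 (n : ℕ) (ε : ℝ) (hε0 : 0 < ε) (hε1 : ε < 1)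
    (f : NoisyCube.Cube n → ℝ) (hf : ∀ x, 0 ≤ f x) (hmean : (𝔼 x, f x) = 1) :
    NoisyCube.ent (NoisyCube.noise ε f) ≤
      NoisyCube.subsetExpect ((1 - 2 * ε) ^ 2)
          (fun T => NoisyCube.condEnt f T - ∑ i ∈ T, NoisyCube.condEnt f {i})
        + ∑ i : Fin n, NoisyCube.mrsGerber (NoisyCube.condEnt f {i}) ε := by
  -- The interval is `[-1, 1]` because `1 - 2 * ε` is negative for `ε > 1 / 2`. The subtracted sum
  -- is affine in each `r i ^ 2`, so the interpolation reproduces it exactly; at the indicator of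
  -- `T` it is the sum over `i ∈ T`, and at `ρ` it cancels the negative part of the errors.
  have hle := NoisyCube.le_sum_powerset_of_coordinatewise (I := Set.Icc (-1 : ℝ) 1)
    (by simp) (by simp) (ρ := 1 - 2 * ε) (q := (1 - 2 * ε) ^ 2)
    ⟨by linarith, by linarith⟩ (sq_nonneg _) (by nlinarith)
    (fun r => NoisyCube.ent (NoisyCube.productNoise r f)
      - ∑ i, r i ^ 2 * NoisyCube.condEnt f {i})
    (fun i => NoisyCube.mrsGerber (NoisyCube.condEnt f {i}) ε
      - (1 - 2 * ε) ^ 2 * NoisyCube.condEnt f {i})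
    (fun r hr i => by
      have h := NoisyCube.ent_productNoise_update_le hf hmean hε0.le hε1.le hr i
      have hsum : ∀ t : ℝ, ∑ j, Function.update r i t j ^ 2 * NoisyCube.condEnt f {j}
          = t ^ 2 * NoisyCube.condEnt f {i}
            + ∑ j ∈ Finset.univ.erase i, r j ^ 2 * NoisyCube.condEnt f {j} := by
        intro t
        rw [← Finset.add_sum_erase _ _ (Finset.mem_univ i), Function.update_self]
        congr 1
        refine Finset.sum_congr rfl fun j hj => ?_
        rw [Function.update_of_ne (Finset.ne_of_mem_erase hj)]
      simp only [hsum]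
      linarith)
    Finset.univ (fun _ => 0) (by simp)
  simp only [Finset.piecewise_univ, Finset.powerset_univ, Finset.card_univ,
    Fintype.card_fin] at hle
  rw [← NoisyCube.noise_eq_productNoise, ← Finset.mul_sum, Finset.sum_sub_distrib,
    ← Finset.mul_sum] at hle
  have hT : ∀ T : Finset (Fin n), ∑ i, (if i ∈ T then (1 : ℝ) else 0) ^ 2
      * NoisyCube.condEnt f {i} = ∑ i ∈ T, NoisyCube.condEnt f {i} := by
    intro T
    simp [ite_pow]
  simp only [hT, ← NoisyCube.condExpect_eq_productNoise] at hle
  rw [NoisyCube.subsetExpect]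
  simp only [NoisyCube.condEnt] at hle ⊢
  linarith
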